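/- For every integer $n\geqslant 1$ let $B_n=\sum_{1\leqslant k\leqslant n} {n\brace k}$ be the $n$-th Bell number, where ${n\brace k}$ denotes the Stirling number of the second kind (the number of partitions of an $n$-element set into $k$ non-empty blocks), and let $\omega_n=W(n)$, where $W$ is the principal branch of the Lambert $W$-function; that is, $\omega_n$ is the unique positive solution of $\omega_n e^{\omega_n}=n$. Then, as $n\to\infty$, \[ B_n=\frac{e^{\left(\omega_n-1+\frac{1}{\omega_n}\right)n-1}}{\sqrt{\omega_n+1}}\left(1+O\left(n^{-1}(\log n)^2\right)\right). \] -/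

import Mathlib

/-- The principal (real) branch of the Lambert `W`-function: for `-1/e ≤ x`, the unique solution
`w ≥ -1` of the equation `w * exp w = x`. -/
noncomputable def lambertW (x : ℝ) : ℝ :=
  Function.invFunOn (fun w : ℝ => w * Real.exp w) (Set.Ici (-1)) x

theorem strictMonoOn_mul_exp :
    StrictMonoOn (fun w : ℝ => w * Real.exp w) (Set.Ici (-1)) := by
  apply strictMonoOn_of_deriv_pos (convex_Ici _) (by fun_prop)
  intro w hw
  rw [interior_Ici, Set.mem_Ioi] at hw
  have h : HasDerivAt (fun w : ℝ => w * Real.exp w) (1 * Real.exp w + w * Real.exp w) w :=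
    (hasDerivAt_id w).mul (Real.hasDerivAt_exp w)
  rw [h.deriv, ← add_mul]
  exact mul_pos (by linarith) (Real.exp_pos w)

theorem lambertW_spec {x : ℝ} (hx : -Real.exp (-1) ≤ x) :
    -1 ≤ lambertW x ∧ lambertW x * Real.exp (lambertW x) = x := by
  have hex : ∃ w ∈ Set.Ici (-1 : ℝ), (fun w : ℝ => w * Real.exp w) w = x := by
    have hmem : x ∈ Set.Icc ((fun w : ℝ => w * Real.exp w) (-1))
        ((fun w : ℝ => w * Real.exp w) |x|) := by
      refine ⟨by simpa using hx, ?_⟩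
      have h1 : (1 : ℝ) ≤ Real.exp |x| := Real.one_le_exp (abs_nonneg x)
      have h2 := le_abs_self x
      have h3 := abs_nonneg x
      show x ≤ |x| * Real.exp |x|
      nlinarith
    have hab : (-1 : ℝ) ≤ |x| := by linarith [abs_nonneg x]
    obtain ⟨w, hw, hwx⟩ := intermediate_value_Icc hab
      (f := fun w : ℝ => w * Real.exp w) (by fun_prop) hmem
    exact ⟨w, hw.1, hwx⟩
  exact ⟨Function.invFunOn_mem hex, Function.invFunOn_eq hex⟩

theorem lambertW_mul_exp_self {w : ℝ} (hw : -1 ≤ w) : lambertW (w * Real.exp w) = w := by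
  have hx : -Real.exp (-1) ≤ w * Real.exp w := by
    have := strictMonoOn_mul_exp.monotoneOn (Set.mem_Ici.2 le_rfl) (Set.mem_Ici.2 hw) hw
    simpa using this
  obtain ⟨h1, h2⟩ := lambertW_spec hx
  exact strictMonoOn_mul_exp.injOn h1 hw h2

theorem lambertW_pos {x : ℝ} (hx : 0 < x) : 0 < lambertW x := by
  have h := (lambertW_spec (x := x) (by linarith [Real.exp_pos (-1)])).2
  by_contra! hle
  have := mul_nonpos_of_nonpos_of_nonneg hle (Real.exp_pos (lambertW x)).le
  linarith

theorem stirlingSecond_succ_eq_sum_choose (n k : ℕ) :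
    Nat.stirlingSecond (n + 1) (k + 1) =
      ∑ j ∈ Finset.range (n + 1), n.choose j * Nat.stirlingSecond j k := by
  induction n generalizing k with
  | zero => cases k <;> simp [Nat.stirlingSecond]
  | succ n ih =>
    have key : ∑ j ∈ Finset.range (n + 2), (n + 1).choose j * Nat.stirlingSecond j k
        = ∑ j ∈ Finset.range (n + 1), n.choose j * Nat.stirlingSecond j k
          + ∑ j ∈ Finset.range (n + 1), n.choose j * Nat.stirlingSecond (j + 1) k := by
      rw [Finset.sum_range_succ']
      simp only [Nat.choose_succ_succ', add_mul, Finset.sum_add_distrib]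
      rw [Finset.sum_range_succ' (fun j => n.choose j * Nat.stirlingSecond j k),
        Finset.sum_range_succ (fun j => n.choose (j + 1) * Nat.stirlingSecond (j + 1) k)]
      simp
      ring
    rw [key, ← ih, Nat.stirlingSecond_succ_succ]
    cases k with
    | zero => simp [Nat.stirlingSecond_one_right]
    | succ k =>
      simp only [Nat.stirlingSecond_succ_succ _ k, mul_add, Finset.sum_add_distrib]
      rw [← ih k]
      have : ∑ j ∈ Finset.range (n + 1), n.choose j * ((k + 1) * Nat.stirlingSecond j (k + 1))
          = (k + 1) * Nat.stirlingSecond (n + 1) (k + 1 + 1) := by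
        rw [ih, Finset.mul_sum]
        exact Finset.sum_congr rfl fun _ _ => by ring
      rw [this, Nat.stirlingSecond_succ_succ n k]
      ring

/-- The Bell numbers are the row sums of the Stirling numbers of the second kind. -/
theorem bell_eq_sum_stirlingSecond {n : ℕ} (hn : 1 ≤ n) :
    Nat.bell n = ∑ k ∈ Finset.Icc 1 n, Nat.stirlingSecond n k := by
  have main : ∀ n N : ℕ, n ≤ N →
      Nat.bell n = ∑ k ∈ Finset.range (N + 1), Nat.stirlingSecond n k := by
    intro n
    induction n using Nat.strong_induction_on with
    | _ n ih =>
      intro N hN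
      rcases n with _ | n
      · rw [Finset.sum_range_succ']; simp
      · obtain ⟨N, rfl⟩ : ∃ M, N = M + 1 := ⟨N - 1, by omega⟩
        rw [Finset.sum_range_succ', Nat.stirlingSecond_succ_zero, add_zero]
        simp only [stirlingSecond_succ_eq_sum_choose]
        rw [Finset.sum_comm, Nat.bell_succ', Finset.Nat.sum_antidiagonal_swap.symm,
          Finset.Nat.sum_antidiagonal_eq_sum_range_succ_mk]
        refine Finset.sum_congr rfl fun j hj => ?_
        have hj' : j ≤ n := by simpa [Nat.lt_succ_iff] using hj
        simp only [Prod.fst_swap, Prod.snd_swap]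
        rw [ih j (by omega) N (by omega), Finset.mul_sum, Nat.choose_symm hj']
  rw [main n n le_rfl]
  refine (Finset.sum_subset (fun k hk => ?_) fun k hk hk' => ?_).symm
  · simp only [Finset.mem_Icc, Finset.mem_range] at hk ⊢; omega
  · have hk0 : k = 0 := by
      simp only [Finset.mem_Icc, Finset.mem_range] at hk hk'; omega
    obtain ⟨m, rfl⟩ : ∃ m, n = m + 1 := ⟨n - 1, by omega⟩
    rw [hk0, Nat.stirlingSecond_succ_zero]

/-!
The proof is the saddle-point method on the exponential generating function
`exp (exp z - 1) = ∑ Bₙ zⁿ / n!`. Cauchy's formula on the circle of radius `r = W(n)` writes `Bₙ` as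
`n! / (2π rⁿ)` times an integral over `θ ∈ (-π, π]` (`bell_eq_integral`); since `Bₙ` is real, only
the real part of the integrand matters, and the cubic term of its exponent contributes through the
square of the phase alone.

The choice `r e^r = n` kills the linear term of the exponent, whose quadratic term is `-b θ² / 2`
with `b = (r² + r) e^r`. The Taylor errors come from `e^{r e^{iθ}} = ∑ (r^m / m!) e^{i m θ}`: the
elementary bounds for `cos (m θ)` and `sin (m θ)` are averaged against the weights `r^m / m!`, whose
first four moments are explicit (`abs_exp_cos_sub_le`, `abs_exp_sin_sub_le`). For `|θ| ≤ 1 / (2r)`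
the normalised integrand then differs from the Gaussian by `O(e^{-r}) e^{-b θ² / 8}`
(`abs_bellKernel_sub_gaussian_le_of_central`); elsewhere it is at most `e^{-e^r / (60 r²)}`
(`abs_bellKernel_le`). Integration gives `√(2π / b)` with relative error `O(e^{-r}) = O(r / n)`
(`exists_abs_sqrt_mul_integral_bellKernel_sub_one_le`).

Stirling's formula with relative error `O(1 / n)` follows from Robbins' stepwise bound
(`abs_stirlingSeq_div_sub_one_le`). The exact factorisation `bell_eq_main_mul` combines the two, and
`r ≤ log n` bounds the total error by `O(log n / n)`.
-/

/-! ### The exponential generating function of the Bell numbers -/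

/-- The Bell numbers are the Taylor coefficients of `exp (exp z - 1)`: the recursion
`bell_succ'` is the Leibniz rule applied to `F' = exp * F`. -/
theorem iteratedDeriv_exp_exp_sub_one_zero (n : ℕ) :
    iteratedDeriv n (fun z : ℂ => Complex.exp (Complex.exp z - 1)) 0 = (Nat.bell n : ℂ) := by
  have hderiv : deriv (fun z : ℂ => Complex.exp (Complex.exp z - 1)) =
      Complex.exp * fun z : ℂ => Complex.exp (Complex.exp z - 1) := by
    funext z
    have h := ((Complex.hasDerivAt_exp z).sub_const 1).cexp
    rw [h.deriv, Pi.mul_apply, mul_comm]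
  induction n using Nat.strong_induction_on with
  | _ n ih =>
    rcases n with _ | n
    · simp
    · rw [iteratedDeriv_succ', hderiv, iteratedDeriv_mul (by fun_prop) (by fun_prop),
        Nat.bell_succ', Finset.Nat.sum_antidiagonal_eq_sum_range_succ_mk]
      push_cast
      refine Finset.sum_congr rfl fun i _ => ?_
      rw [ih (n - i) (by omega), iteratedDeriv_eq_iterate, Complex.iter_deriv_exp]
      simp

/-- Cauchy's formula on the circle of radius `r`, in real form. -/
theorem bell_eq_integral (n : ℕ) {r : ℝ} (hr : 0 < r) :
    (Nat.bell n : ℝ) = (n.factorial : ℝ) / (2 * Real.pi * r ^ n) *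
      ∫ θ in -Real.pi..Real.pi,
        Real.exp (Real.exp (r * Real.cos θ) * Real.cos (r * Real.sin θ) - 1) *
          Real.cos (Real.exp (r * Real.cos θ) * Real.sin (r * Real.sin θ) - n * θ) := by
  set F : ℂ → ℂ := fun z => Complex.exp (Complex.exp z - 1) with hF
  have hdiff : Differentiable ℂ F := by fun_prop
  have hcauchy := DiffContOnCl.circleIntegral_one_div_sub_center_pow_smul hr n
    (hdiff.diffContOnCl (s := Metric.ball 0 r))
  rw [iteratedDeriv_exp_exp_sub_one_zero] at hcauchy
  -- The integrand of Cauchy's formula in the angular variable.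
  set g : ℝ → ℂ := fun θ => Complex.exp (-(n * θ * Complex.I)) * F (r * Complex.exp (θ * Complex.I))
    with hg
  have hcircle : (∮ z in C(0, r), (1 / (z - 0) ^ (n + 1)) • F z) =
      Complex.I / r ^ n * ∫ θ in (0 : ℝ)..2 * Real.pi, g θ := by
    rw [circleIntegral, ← intervalIntegral.integral_const_mul]
    refine intervalIntegral.integral_congr fun θ _ => ?_
    have hr' : (r : ℂ) ≠ 0 := by exact_mod_cast hr.ne'
    simp only [deriv_circleMap, circleMap, zero_add, sub_zero, smul_eq_mul, hg]
    have hexp : Complex.exp (-(n * θ * Complex.I)) = (Complex.exp (θ * Complex.I) ^ n)⁻¹ := by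
      rw [Complex.exp_neg, ← Complex.exp_nat_mul, mul_assoc]
    rw [hexp]
    have := Complex.exp_ne_zero (θ * Complex.I)
    field_simp
    ring
  have hper : Function.Periodic g (2 * Real.pi) := by
    intro θ
    have h1 : Complex.exp (((θ + 2 * Real.pi : ℝ) : ℂ) * Complex.I) =
        Complex.exp (θ * Complex.I) := by
      push_cast
      rw [add_mul]
      exact Complex.exp_periodic _
    have h2 : Complex.exp (-(n * ((θ + 2 * Real.pi : ℝ) : ℂ) * Complex.I)) =
        Complex.exp (-(n * θ * Complex.I)) := by
      rw [Complex.exp_neg, Complex.exp_neg, mul_assoc, mul_assoc, Complex.exp_nat_mul,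
        Complex.exp_nat_mul, h1]
    simp only [hg, h1, h2]
  have hshift : ∫ θ in (0 : ℝ)..2 * Real.pi, g θ = ∫ θ in -Real.pi..Real.pi, g θ := by
    have := hper.intervalIntegral_add_eq 0 (-Real.pi)
    rw [zero_add] at this
    rw [this]
    congr 1
    ring
  rw [hcircle, hshift] at hcauchy
  have hint : ((2 * Real.pi * r ^ n / n.factorial * Nat.bell n : ℝ) : ℂ) =
      ∫ θ in -Real.pi..Real.pi, g θ := by
    have hr' : (r : ℂ) ≠ 0 := by exact_mod_cast hr.ne'
    rw [smul_eq_mul] at hcauchy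
    have h3 : (∫ θ in -Real.pi..Real.pi, g θ) =
        (r : ℂ) ^ n * (2 * Real.pi / n.factorial * Nat.bell n) := by
      have h4 : Complex.I * (∫ θ in -Real.pi..Real.pi, g θ) =
          Complex.I * ((r : ℂ) ^ n * (2 * Real.pi / n.factorial * Nat.bell n)) := by
        field_simp at hcauchy ⊢
        linear_combination hcauchy
      exact mul_left_cancel₀ Complex.I_ne_zero h4
    rw [h3]
    push_cast
    ring
  have hre : ∀ θ : ℝ, (g θ).re =
      Real.exp (Real.exp (r * Real.cos θ) * Real.cos (r * Real.sin θ) - 1) *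
        Real.cos (Real.exp (r * Real.cos θ) * Real.sin (r * Real.sin θ) - n * θ) := by
    intro θ
    simp only [hg, hF]
    rw [← Complex.exp_add, Complex.exp_re]
    simp [Complex.exp_re, Complex.exp_im]
    ring_nf
  have hgc : Continuous g := by fun_prop
  have hreal : 2 * Real.pi * r ^ n / n.factorial * Nat.bell n =
      ∫ θ in -Real.pi..Real.pi, (g θ).re := by
    have h5 := Complex.reCLM.intervalIntegral_comp_comm
      (hgc.intervalIntegrable (μ := MeasureTheory.volume) (-Real.pi) Real.pi)
    simp only [Complex.reCLM_apply] at h5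
    rw [h5, ← hint, Complex.ofReal_re]
  simp only [hre] at hreal
  rw [← hreal]
  have hpi := Real.pi_pos
  have hfac : (n.factorial : ℝ) ≠ 0 := by positivity
  field_simp

/-! ### Taylor bounds on the circle -/

theorem Real.cos_le_one_sub_sq_add_pow_four (x : ℝ) :
    Real.cos x ≤ 1 - x ^ 2 / 2 + x ^ 4 / 24 := by
  wlog hx : 0 ≤ x generalizing x
  · have := this (-x) (by linarith)
    simpa [Real.cos_neg, neg_sq, Even.neg_pow (⟨2, rfl⟩ : Even 4)] using this
  have hs := Real.sin_ge_sub_cube (x := x / 2) (by linarith)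
  have hc : Real.cos x = 1 - 2 * Real.sin (x / 2) ^ 2 := by
    rw [Real.sin_sq_eq_half_sub]; ring_nf
  rw [hc]
  set y := x / 2 with hy
  have hxy : x = 2 * y := by rw [hy]; ring
  have hy0 : 0 ≤ y := by positivity
  rw [hxy]
  rcases le_or_gt (y ^ 2) 6 with h6 | h6
  · have h0 : 0 ≤ y - y ^ 3 / 6 := by nlinarith
    have := pow_le_pow_left₀ h0 hs 2
    nlinarith [sq_nonneg (y ^ 3)]
  · nlinarith [sq_nonneg (Real.sin y), sq_nonneg y]

theorem Real.abs_cos_sub_le_pow_four (x : ℝ) :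
    |Real.cos x - 1 + x ^ 2 / 2| ≤ x ^ 4 / 24 := by
  have h1 := Real.cos_le_one_sub_sq_add_pow_four x
  have h2 := Real.one_sub_sq_div_two_le_cos (x := x)
  rw [abs_of_nonneg (by linarith)]
  linarith

theorem Real.abs_sin_sub_self_le (x : ℝ) : |Real.sin x - x| ≤ |x| ^ 3 / 6 := by
  wlog hx : 0 ≤ x generalizing x
  · have := this (-x) (by linarith)
    rwa [Real.sin_neg, abs_neg, ← abs_neg, show -(-Real.sin x - -x) = Real.sin x - x by ring]
      at this
  have h1 := Real.sin_ge_sub_cube hx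
  have h2 := Real.sin_le hx
  rw [abs_of_nonneg hx, abs_le]
  constructor <;> linarith

/-- The step of the moment recursion for the Poisson weights `r ^ m / m!`. -/
theorem hasSum_pow_succ_mul_poisson {r s : ℝ} {k : ℕ}
    (h : HasSum (fun m : ℕ => ((m : ℝ) + 1) ^ k * (r ^ m / m.factorial)) s) :
    HasSum (fun m : ℕ => (m : ℝ) ^ (k + 1) * (r ^ m / m.factorial)) (r * s) := by
  rw [← hasSum_nat_add_iff' 1]
  simp only [Finset.range_one, Finset.sum_singleton, Nat.cast_zero, zero_pow (Nat.succ_ne_zero k),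
    zero_mul, sub_zero]
  refine (h.mul_left r).congr_fun fun m => ?_
  rw [Nat.factorial_succ]
  have : (m.factorial : ℝ) ≠ 0 := by positivity
  push_cast
  field_simp
  ring

theorem hasSum_poisson (r : ℝ) :
    HasSum (fun m : ℕ => r ^ m / m.factorial) (Real.exp r) := by
  have := NormedSpace.expSeries_div_hasSum_exp (𝔸 := ℝ) r
  rwa [← Real.exp_eq_exp_ℝ] at this

theorem hasSum_mul_poisson (r : ℝ) :
    HasSum (fun m : ℕ => (m : ℝ) * (r ^ m / m.factorial)) (r * Real.exp r) := by
  simpa using hasSum_pow_succ_mul_poisson (k := 0) (by simpa using hasSum_poisson r)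

theorem hasSum_sq_mul_poisson (r : ℝ) :
    HasSum (fun m : ℕ => (m : ℝ) ^ 2 * (r ^ m / m.factorial))
      ((r ^ 2 + r) * Real.exp r) := by
  have h := hasSum_pow_succ_mul_poisson (k := 1) (r := r) (s := r * Real.exp r + Real.exp r)
    (((hasSum_mul_poisson r).add (hasSum_poisson r)).congr_fun fun m => by ring)
  convert h using 1
  ring

theorem hasSum_cube_mul_poisson (r : ℝ) :
    HasSum (fun m : ℕ => (m : ℝ) ^ 3 * (r ^ m / m.factorial))
      ((r ^ 3 + 3 * r ^ 2 + r) * Real.exp r) := by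
  have h := hasSum_pow_succ_mul_poisson (k := 2) (r := r)
    ((((hasSum_sq_mul_poisson r).add ((hasSum_mul_poisson r).mul_left 2)).add
      (hasSum_poisson r)).congr_fun fun m => by ring)
  convert h using 1
  ring

theorem hasSum_pow_four_mul_poisson (r : ℝ) :
    HasSum (fun m : ℕ => (m : ℝ) ^ 4 * (r ^ m / m.factorial))
      ((r ^ 4 + 6 * r ^ 3 + 7 * r ^ 2 + r) * Real.exp r) := by
  have h := hasSum_pow_succ_mul_poisson (k := 3) (r := r)
    (((((hasSum_cube_mul_poisson r).add ((hasSum_sq_mul_poisson r).mul_left 3)).add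
      ((hasSum_mul_poisson r).mul_left 3)).add (hasSum_poisson r)).congr_fun fun m => by ring)
  convert h using 1
  ring

theorem hasSum_exp_circle (r θ : ℝ) :
    HasSum (fun m : ℕ => (r ^ m / m.factorial : ℝ) * Complex.exp (m * θ * Complex.I))
      (Complex.exp (r * Complex.exp (θ * Complex.I))) := by
  have h := NormedSpace.expSeries_div_hasSum_exp (𝔸 := ℂ) (r * Complex.exp (θ * Complex.I))
  rw [← Complex.exp_eq_exp_ℂ] at h
  refine h.congr_fun fun m => ?_
  rw [mul_pow, ← Complex.exp_nat_mul, mul_assoc (m : ℂ)]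
  push_cast
  ring

theorem hasSum_cos_mul_poisson (r θ : ℝ) :
    HasSum (fun m : ℕ => Real.cos (m * θ) * (r ^ m / m.factorial))
      (Real.exp (r * Real.cos θ) * Real.cos (r * Real.sin θ)) := by
  have h := Complex.hasSum_re (hasSum_exp_circle r θ)
  convert h using 1
  · funext m
    rw [Complex.re_ofReal_mul]
    simp [Complex.exp_re, mul_comm]
  · simp [Complex.exp_re, Complex.exp_im]

theorem hasSum_sin_mul_poisson (r θ : ℝ) :
    HasSum (fun m : ℕ => Real.sin (m * θ) * (r ^ m / m.factorial))
      (Real.exp (r * Real.cos θ) * Real.sin (r * Real.sin θ)) := by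
  have h := Complex.hasSum_im (hasSum_exp_circle r θ)
  convert h using 1
  · funext m
    rw [Complex.im_ofReal_mul]
    simp [Complex.exp_im, mul_comm]
  · simp [Complex.exp_re, Complex.exp_im]

/-- Quartic Taylor bound for `Re (exp (r e^{iθ}))`, averaging the bound for `cos (m θ)` over the
Poisson weights. -/
theorem abs_exp_cos_sub_le {r : ℝ} (hr : 0 ≤ r) (θ : ℝ) :
    |Real.exp (r * Real.cos θ) * Real.cos (r * Real.sin θ) - Real.exp r +
        (r ^ 2 + r) * Real.exp r * θ ^ 2 / 2| ≤
      (r ^ 4 + 6 * r ^ 3 + 7 * r ^ 2 + r) * Real.exp r * θ ^ 4 / 24 := by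
  have h1 := ((hasSum_cos_mul_poisson r θ).sub (hasSum_poisson r)).add
    ((hasSum_sq_mul_poisson r).mul_right (θ ^ 2 / 2))
  have h2 := (hasSum_pow_four_mul_poisson r).mul_right (θ ^ 4 / 24)
  rw [mul_div_assoc, mul_div_assoc, ← Real.norm_eq_abs]
  refine h1.norm_le_of_bounded h2 fun m => ?_
  have hw : 0 ≤ r ^ m / (m.factorial : ℝ) := by positivity
  have h3 := mul_le_mul_of_nonneg_right (Real.abs_cos_sub_le_pow_four (m * θ)) hw
  rw [← abs_of_nonneg hw, ← abs_mul, abs_of_nonneg hw] at h3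
  rw [Real.norm_eq_abs]
  calc _ = _ := by congr 1; ring
    _ ≤ _ := h3
    _ = _ := by ring

theorem abs_exp_sin_sub_le {r : ℝ} (hr : 0 ≤ r) (θ : ℝ) :
    |Real.exp (r * Real.cos θ) * Real.sin (r * Real.sin θ) - r * Real.exp r * θ| ≤
      (r ^ 3 + 3 * r ^ 2 + r) * Real.exp r * |θ| ^ 3 / 6 := by
  have h1 := (hasSum_sin_mul_poisson r θ).sub ((hasSum_mul_poisson r).mul_right θ)
  have h2 := (hasSum_cube_mul_poisson r).mul_right (|θ| ^ 3 / 6)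
  rw [mul_div_assoc, ← Real.norm_eq_abs]
  refine h1.norm_le_of_bounded h2 fun m => ?_
  have hw : 0 ≤ r ^ m / (m.factorial : ℝ) := by positivity
  have h3 := mul_le_mul_of_nonneg_right (Real.abs_sin_sub_self_le (m * θ)) hw
  rw [← abs_of_nonneg hw, ← abs_mul, abs_of_nonneg hw, abs_mul (m : ℝ), Nat.abs_cast] at h3
  rw [Real.norm_eq_abs]
  calc _ = _ := by congr 1; ring
    _ ≤ _ := h3
    _ = _ := by ring

/-! ### Pointwise comparison with the Gaussian -/

theorem Real.abs_exp_sub_exp_le_of_le {a b c : ℝ} (ha : a ≤ c) (hb : b ≤ c) :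
    |Real.exp a - Real.exp b| ≤ Real.exp c * |a - b| := by
  wlog hab : b ≤ a generalizing a b
  · rw [abs_sub_comm, abs_sub_comm a]
    exact this hb ha (by linarith)
  have h1 : Real.exp b = Real.exp a * Real.exp (b - a) := by rw [← Real.exp_add]; ring_nf
  have h2 := Real.add_one_le_exp (b - a)
  have h3 := Real.exp_le_exp.2 ha
  have h4 := Real.exp_pos a
  rw [abs_of_nonneg (sub_nonneg.2 (Real.exp_le_exp.2 hab)), abs_of_nonneg (by linarith), h1]
  nlinarith

/-- `Re (exp (e^{r e^{iθ}} - e^r - i r e^r θ))`, the integrand of Cauchy's formula for the Bell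
numbers normalised to equal `1` at the saddle point `θ = 0`, when `r e^r = n`. -/
noncomputable def bellKernel (r θ : ℝ) : ℝ :=
  Real.exp (Real.exp (r * Real.cos θ) * Real.cos (r * Real.sin θ) - Real.exp r) *
    Real.cos (Real.exp (r * Real.cos θ) * Real.sin (r * Real.sin θ) - r * Real.exp r * θ)

theorem continuous_bellKernel (r : ℝ) : Continuous (bellKernel r) := by
  unfold bellKernel
  fun_prop

/-- On `|θ| ≤ 1 / (2r)` the quartic error in the exponent is at most half of the quadratic term,
so part of the Gaussian survives and absorbs the powers of `θ` in the Taylor errors. -/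
theorem abs_bellKernel_sub_gaussian_le_of_central {r θ : ℝ} (hr : 1 ≤ r)
    (hθ : r * |θ| ≤ 1 / 2) :
    |bellKernel r θ - Real.exp (-((r ^ 2 + r) * Real.exp r * θ ^ 2) / 2)| ≤
      1664 * Real.exp (-r) * Real.exp (-((r ^ 2 + r) * Real.exp r * θ ^ 2) / 8) := by
  have hA := abs_exp_cos_sub_le (r := r) (by linarith) θ
  have hB := abs_exp_sin_sub_le (r := r) (by linarith) θ
  unfold bellKernel
  set A := Real.exp (r * Real.cos θ) * Real.cos (r * Real.sin θ) - Real.exp r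
  set B := Real.exp (r * Real.cos θ) * Real.sin (r * Real.sin θ) - r * Real.exp r * θ
  set e := Real.exp r with he
  have he0 : 0 < e := Real.exp_pos r
  have hr0 : 0 < r := by linarith
  set x := (r ^ 2 + r) * e * θ ^ 2 with hx
  -- `u` is the lower bound for `x` in terms of which the Taylor errors are expressed.
  set u := r ^ 2 * e * θ ^ 2 with hu
  have hu0 : 0 ≤ u := by positivity
  have hux : u ≤ x := by
    rw [hu, hx]
    gcongr
    linarith
  have hx0 : 0 ≤ x := hu0.trans hux
  have hrinv : Real.exp (-r) = e⁻¹ := Real.exp_neg r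
  have hT4 : r ^ 4 + 6 * r ^ 3 + 7 * r ^ 2 + r ≤ 15 * r ^ 4 := by
    have h1 : r ^ 3 ≤ r ^ 4 := pow_le_pow_right₀ hr (by norm_num)
    have h2 : r ^ 2 ≤ r ^ 4 := pow_le_pow_right₀ hr (by norm_num)
    have h3 : r ^ 1 ≤ r ^ 4 := pow_le_pow_right₀ hr (by norm_num)
    linarith
  have hT3 : r ^ 3 + 3 * r ^ 2 + r ≤ 5 * r ^ 3 := by
    have h2 : r ^ 2 ≤ r ^ 3 := pow_le_pow_right₀ hr (by norm_num)
    have h3 : r ^ 1 ≤ r ^ 3 := pow_le_pow_right₀ hr (by norm_num)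
    linarith
  have hA' : |A + x / 2| ≤ 15 * r ^ 4 * e * θ ^ 4 / 24 := by
    refine hA.trans ?_
    gcongr
  have hB' : |B| ≤ 5 * r ^ 3 * e * |θ| ^ 3 / 6 := by
    refine hB.trans ?_
    gcongr
  have hθ2 : r ^ 2 * θ ^ 2 ≤ 1 / 4 := by
    rw [← sq_abs θ, ← mul_pow]
    calc (r * |θ|) ^ 2 ≤ (1 / 2) ^ 2 := by gcongr
      _ = 1 / 4 := by norm_num
  have hA1 : |A + x / 2| ≤ x / 4 := by
    have : r ^ 4 * e * θ ^ 4 = (r ^ 2 * θ ^ 2) * u := by rw [hu]; ring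
    nlinarith
  have hA2 : |A + x / 2| ≤ e⁻¹ * x ^ 2 := by
    have h1 : r ^ 4 * e * θ ^ 4 = e⁻¹ * u ^ 2 := by rw [hu]; field_simp
    have h2 : e⁻¹ * u ^ 2 ≤ e⁻¹ * x ^ 2 := by gcongr
    have h3 : 0 ≤ e⁻¹ * u ^ 2 := by positivity
    linarith
  have hB2 : B ^ 2 ≤ e⁻¹ * x ^ 3 := by
    have h1 : B ^ 2 ≤ (5 * r ^ 3 * e * |θ| ^ 3 / 6) ^ 2 := by
      rw [← sq_abs B]
      gcongr
    have h2 : (5 * r ^ 3 * e * |θ| ^ 3 / 6) ^ 2 = 25 / 36 * (e⁻¹ * u ^ 3) := by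
      rw [hu, show (5 * r ^ 3 * e * |θ| ^ 3 / 6) ^ 2 = 25 / 36 * (r ^ 6 * e ^ 2 * (|θ| ^ 2) ^ 3) by
        ring, sq_abs]
      field_simp
    have h3 : e⁻¹ * u ^ 3 ≤ e⁻¹ * x ^ 3 := by gcongr
    have h4 : 0 ≤ e⁻¹ * u ^ 3 := by positivity
    linarith
  have hAle : A ≤ -x / 4 := by linarith [(abs_le.1 hA1).2]
  have hexp : |Real.exp A - Real.exp (-x / 2)| ≤ Real.exp (-x / 4) * (e⁻¹ * x ^ 2) := by
    have h1 := Real.abs_exp_sub_exp_le_of_le hAle (show -x / 2 ≤ -x / 4 by linarith)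
    rw [show A - -x / 2 = A + x / 2 by ring] at h1
    exact h1.trans (by gcongr)
  have hcos : |Real.cos B - 1| ≤ e⁻¹ * x ^ 3 / 2 := by
    have h1 := Real.one_sub_sq_div_two_le_cos (x := B)
    have h2 := Real.cos_le_one B
    rw [abs_of_nonpos (by linarith)]
    linarith
  have hmain : |Real.exp A * Real.cos B - Real.exp (-x / 2)| ≤
      Real.exp (-x / 4) * (e⁻¹ * (x ^ 3 / 2 + x ^ 2)) := by
    have h1 : Real.exp A * Real.cos B - Real.exp (-x / 2) =
        Real.exp A * (Real.cos B - 1) + (Real.exp A - Real.exp (-x / 2)) := by ring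
    rw [h1]
    refine (abs_add_le _ _).trans ?_
    rw [abs_mul, abs_of_pos (Real.exp_pos A)]
    have h2 : Real.exp A * |Real.cos B - 1| ≤ Real.exp (-x / 4) * (e⁻¹ * x ^ 3 / 2) := by
      gcongr
    linarith
  -- `1664 = 3! * 8 ^ 3 / 2 + 2! * 8 ^ 2`, from `t ^ k / k! ≤ exp t` at `t = x / 8`.
  have hpoly : x ^ 3 / 2 + x ^ 2 ≤ 1664 * Real.exp (x / 8) := by
    have h2 := Real.pow_div_factorial_le_exp (x / 8) (by positivity) 2
    have h3 := Real.pow_div_factorial_le_exp (x / 8) (by positivity) 3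
    norm_num [Nat.factorial] at h2 h3
    linarith
  rw [hrinv]
  calc _ ≤ _ := hmain
    _ ≤ Real.exp (-x / 4) * (e⁻¹ * (1664 * Real.exp (x / 8))) := by gcongr
    _ = 1664 * e⁻¹ * (Real.exp (-x / 4) * Real.exp (x / 8)) := by ring
    _ = _ := by
      rw [← Real.exp_add]
      ring_nf

/-- Away from the saddle point, `|e^{r e^{iθ}}| = e^{r cos θ}` is smaller than `e^r` by a margin
quadratic in `θ`. -/
theorem abs_bellKernel_le {r θ : ℝ} (hr : 1 ≤ r) (hθ : |θ| ≤ Real.pi) :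
    |bellKernel r θ| ≤ Real.exp (-(Real.exp r * θ ^ 2 / 15)) := by
  have hpi := Real.pi_pos
  have hpi2 : Real.pi ^ 2 ≤ 10 := by nlinarith [Real.pi_lt_d2, Real.pi_gt_three]
  have hcos := Real.cos_le_one_sub_mul_cos_sq hθ
  have hθ2 : θ ^ 2 ≤ Real.pi ^ 2 := by
    rw [← sq_abs]
    gcongr
  set y := r * (2 / Real.pi ^ 2 * θ ^ 2) with hy
  have hr0 : 0 < r := by linarith
  have hy0 : 0 ≤ y := by positivity
  have hy2 : y ≤ 2 * r := by
    have : 2 / Real.pi ^ 2 * θ ^ 2 ≤ 2 := by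
      rw [div_mul_eq_mul_div, div_le_iff₀ (by positivity)]
      linarith
    nlinarith
  have hyθ : r * θ ^ 2 / 5 ≤ y := by
    rw [hy, div_mul_eq_mul_div, ← mul_div_assoc, div_le_div_iff₀ (by norm_num) (by positivity)]
    nlinarith [mul_nonneg hr0.le (sq_nonneg θ)]
  have hdecay : Real.exp (-y) ≤ 1 - θ ^ 2 / 15 := by
    have h1 : Real.exp (-y) ≤ (1 + y)⁻¹ := by
      rw [Real.exp_neg]
      gcongr
      linarith [Real.add_one_le_exp y]
    refine h1.trans ?_
    rw [inv_le_iff_one_le_mul₀ (by linarith)]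
    nlinarith [mul_nonneg (sq_nonneg θ) (show (0:ℝ) ≤ 3 * r - 1 - y by linarith)]
  have hexp : Real.exp (r * Real.cos θ) ≤ Real.exp r * (1 - θ ^ 2 / 15) := by
    calc Real.exp (r * Real.cos θ) ≤ Real.exp (r + -y) := by
          gcongr
          rw [hy]
          nlinarith
      _ = Real.exp r * Real.exp (-y) := Real.exp_add _ _
      _ ≤ _ := by gcongr
  unfold bellKernel
  rw [abs_mul, abs_of_pos (Real.exp_pos _)]
  refine (mul_le_of_le_one_right (Real.exp_pos _).le (Real.abs_cos_le_one _)).trans ?_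
  gcongr
  have h1 : Real.exp (r * Real.cos θ) * Real.cos (r * Real.sin θ) ≤ Real.exp (r * Real.cos θ) :=
    mul_le_of_le_one_right (Real.exp_pos _).le (Real.cos_le_one _)
  linarith

/-- For `|θ| ≥ 1 / (2r)` the Gaussian itself is within the error allowed near the saddle point, so
it may be integrated over the whole line. -/
theorem gaussian_le_of_tail {r θ : ℝ} (hr : 1 ≤ r) (hθ : 1 / 2 ≤ r * |θ|) :
    Real.exp (-((r ^ 2 + r) * Real.exp r * θ ^ 2) / 2) ≤
      1664 * Real.exp (-r) * Real.exp (-((r ^ 2 + r) * Real.exp r * θ ^ 2) / 8) := by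
  set e := Real.exp r with he
  have he0 : 0 < e := Real.exp_pos r
  have hθ2 : 1 / 4 ≤ r ^ 2 * θ ^ 2 := by
    rw [← sq_abs θ, ← mul_pow]
    calc (1 / 4 : ℝ) = (1 / 2) ^ 2 := by norm_num
      _ ≤ (r * |θ|) ^ 2 := by gcongr
  set x := (r ^ 2 + r) * e * θ ^ 2 with hx
  have hx1 : e / 4 ≤ x := by
    have h1 : 0 ≤ r * e * θ ^ 2 := by positivity
    have h2 : e * (1 / 4) ≤ e * (r ^ 2 * θ ^ 2) := by gcongr
    rw [hx]
    linarith
  have h1 : Real.exp (-(3 * x / 8)) ≤ 1664 * e⁻¹ := by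
    rw [Real.exp_neg]
    calc (Real.exp (3 * x / 8))⁻¹ ≤ (e / 1664)⁻¹ := by
          gcongr
          linarith [Real.add_one_le_exp (3 * x / 8)]
      _ = 1664 * e⁻¹ := by rw [inv_div]; ring
  rw [Real.exp_neg r, ← he]
  calc Real.exp (-x / 2) = Real.exp (-(3 * x / 8)) * Real.exp (-x / 8) := by
        rw [← Real.exp_add]; ring_nf
    _ ≤ _ := by gcongr

/-- The comparison on the whole line, the kernel being extended by zero outside `(-π, π]`. -/
theorem abs_indicator_bellKernel_sub_gaussian_le {r : ℝ} (hr : 1 ≤ r) (θ : ℝ) :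
    |(Set.Ioc (-Real.pi) Real.pi).indicator (bellKernel r) θ -
        Real.exp (-((r ^ 2 + r) * Real.exp r * θ ^ 2) / 2)| ≤
      1664 * Real.exp (-r) * Real.exp (-((r ^ 2 + r) * Real.exp r * θ ^ 2) / 8) +
        (Set.Ioc (-Real.pi) Real.pi).indicator
          (fun _ => Real.exp (-(Real.exp r / (60 * r ^ 2)))) θ := by
  have hr0 : 0 < r := by linarith
  by_cases hmem : θ ∈ Set.Ioc (-Real.pi) Real.pi
  · rw [Set.indicator_of_mem hmem, Set.indicator_of_mem hmem]
    rcases le_total (r * |θ|) (1 / 2) with h | h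
    · have := abs_bellKernel_sub_gaussian_le_of_central hr h
      linarith [Real.exp_pos (-(Real.exp r / (60 * r ^ 2)))]
    · have h1 := gaussian_le_of_tail hr h
      have h2 := abs_bellKernel_le hr (abs_le.2 ⟨hmem.1.le, hmem.2⟩)
      have hθ2 : 1 / 4 ≤ r ^ 2 * θ ^ 2 := by
        rw [← sq_abs θ, ← mul_pow]
        calc (1 / 4 : ℝ) = (1 / 2) ^ 2 := by norm_num
          _ ≤ (r * |θ|) ^ 2 := by gcongr
      have h3 : Real.exp (-(Real.exp r * θ ^ 2 / 15)) ≤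
          Real.exp (-(Real.exp r / (60 * r ^ 2))) := by
        rw [Real.exp_le_exp, neg_le_neg_iff, div_le_div_iff₀ (by positivity) (by norm_num)]
        nlinarith [Real.exp_pos r]
      refine (abs_sub _ _).trans ?_
      rw [abs_of_pos (Real.exp_pos (-((r ^ 2 + r) * Real.exp r * θ ^ 2) / 2))]
      linarith
  · rw [Set.indicator_of_notMem hmem, Set.indicator_of_notMem hmem, zero_sub, abs_neg,
      abs_of_pos (Real.exp_pos _), add_zero]
    refine gaussian_le_of_tail hr ?_
    have h1 : Real.pi ≤ |θ| := by
      by_contra! h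
      exact hmem ⟨(abs_lt.1 h).1, (abs_lt.1 h).2.le⟩
    nlinarith [Real.pi_gt_three]

/-! ### The saddle-point integral -/

theorem abs_integral_bellKernel_sub_le {r : ℝ} (hr : 1 ≤ r) :
    |(∫ θ in -Real.pi..Real.pi, bellKernel r θ) -
        √(2 * Real.pi / ((r ^ 2 + r) * Real.exp r))| ≤
      3328 * Real.exp (-r) * √(2 * Real.pi / ((r ^ 2 + r) * Real.exp r)) +
        2 * Real.pi * Real.exp (-(Real.exp r / (60 * r ^ 2))) := by
  have hpi := Real.pi_pos
  set b := (r ^ 2 + r) * Real.exp r with hb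
  have hb0 : 0 < b := by positivity
  set D := Real.exp (-(Real.exp r / (60 * r ^ 2)))
  have hs : MeasurableSet (Set.Ioc (-Real.pi) Real.pi) := measurableSet_Ioc
  have hg2 : ∀ θ : ℝ, Real.exp (-(b * θ ^ 2) / 2) = Real.exp (-(b / 2) * θ ^ 2) := fun θ => by
    ring_nf
  have hg8 : ∀ θ : ℝ, Real.exp (-(b * θ ^ 2) / 8) = Real.exp (-(b / 8) * θ ^ 2) := fun θ => by
    ring_nf
  have hpt := abs_indicator_bellKernel_sub_gaussian_le hr
  simp only [← hb, hg2, hg8] at hpt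
  have i1 : MeasureTheory.Integrable
      ((Set.Ioc (-Real.pi) Real.pi).indicator (bellKernel r)) :=
    (MeasureTheory.integrable_indicator_iff hs).2
      ((continuous_bellKernel r).integrableOn_Ioc)
  have i2 := integrable_exp_neg_mul_sq (b := b / 2) (by positivity)
  have i8 := integrable_exp_neg_mul_sq (b := b / 8) (by positivity)
  have iD : MeasureTheory.Integrable
      ((Set.Ioc (-Real.pi) Real.pi).indicator (fun _ : ℝ => D)) :=
    (MeasureTheory.integrable_indicator_iff hs).2 (by simp)
  have hle := MeasureTheory.norm_integral_le_of_norm_le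
    ((i8.const_mul (1664 * Real.exp (-r))).add iD)
    (Filter.Eventually.of_forall fun θ => (Real.norm_eq_abs _).trans_le (hpt θ))
  rw [MeasureTheory.integral_sub i1 i2, MeasureTheory.integral_indicator hs,
    integral_gaussian, Real.norm_eq_abs] at hle
  simp only [Pi.add_apply] at hle
  rw [MeasureTheory.integral_add (i8.const_mul _) iD, MeasureTheory.integral_const_mul,
    integral_gaussian, MeasureTheory.integral_indicator hs, MeasureTheory.setIntegral_const,
    MeasureTheory.measureReal_def, Real.volume_Ioc,
    ENNReal.toReal_ofReal (by linarith), smul_eq_mul] at hle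
  rw [intervalIntegral.integral_of_le (by linarith)]
  have e2 : Real.pi / (b / 2) = 2 * Real.pi / b := by field_simp
  have e8 : √(Real.pi / (b / 8)) = 2 * √(2 * Real.pi / b) := by
    rw [show Real.pi / (b / 8) = 2 ^ 2 * (2 * Real.pi / b) by field_simp; norm_num,
      Real.sqrt_mul (by norm_num), Real.sqrt_sq (by norm_num)]
  rw [e2, e8] at hle
  linarith

/-- Laplace's method: the relative error is `O(e^{-r})`, uniformly in `r ≥ 1`. -/
theorem exists_abs_sqrt_mul_integral_bellKernel_sub_one_le :
    ∃ C : ℝ, 0 ≤ C ∧ ∀ r : ℝ, 1 ≤ r →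
      |√((r ^ 2 + r) * Real.exp r / (2 * Real.pi)) *
          (∫ θ in -Real.pi..Real.pi, bellKernel r θ) - 1| ≤ C * Real.exp (-r) := by
  refine ⟨3328 + 4 * 7200 * 3840, by norm_num, fun r hr => ?_⟩
  have hpi := Real.pi_pos
  have h := abs_integral_bellKernel_sub_le hr
  have hr0 : 0 < r := by linarith
  set b := (r ^ 2 + r) * Real.exp r with hb
  have hb0 : 0 < b := by positivity
  set J := ∫ θ in -Real.pi..Real.pi, bellKernel r θ
  set D := Real.exp (-(Real.exp r / (60 * r ^ 2))) with hD
  have hinv : √(b / (2 * Real.pi)) * √(2 * Real.pi / b) = 1 := by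
    rw [← Real.sqrt_mul (by positivity), show b / (2 * Real.pi) * (2 * Real.pi / b) = 1 by
      field_simp, Real.sqrt_one]
  have h1 : √(b / (2 * Real.pi)) * J - 1 =
      √(b / (2 * Real.pi)) * (J - √(2 * Real.pi / b)) := by rw [mul_sub, hinv]
  rw [h1, abs_mul, abs_of_nonneg (Real.sqrt_nonneg _)]
  have h2 : √(b / (2 * Real.pi)) * |J - √(2 * Real.pi / b)| ≤
      √(b / (2 * Real.pi)) * (3328 * Real.exp (-r) * √(2 * Real.pi / b) + 2 * Real.pi * D) := by
    gcongr
  have h3 : √(b / (2 * Real.pi)) * (3328 * Real.exp (-r) * √(2 * Real.pi / b) + 2 * Real.pi * D) =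
      3328 * Real.exp (-r) + √(b / (2 * Real.pi)) * (2 * Real.pi) * D := by
    linear_combination (3328 * Real.exp (-r)) * hinv
  -- Powers of `r` are absorbed by a spare factor `e^{r/2}`.
  set s := Real.exp (r / 2) with hs
  have hs0 : 0 < s := Real.exp_pos _
  have hss : Real.exp r = s ^ 2 := by rw [hs, ← Real.exp_nat_mul]; ring_nf
  have h4 : √(b / (2 * Real.pi)) * (2 * Real.pi) ≤ 4 * (r * s) := by
    have h41 : √(b / (2 * Real.pi)) * (2 * Real.pi) = √(2 * Real.pi * b) := by
      nth_rewrite 2 [← Real.sqrt_sq (show (0:ℝ) ≤ 2 * Real.pi by positivity)]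
      rw [← Real.sqrt_mul (by positivity)]
      congr 1
      field_simp
    rw [h41, Real.sqrt_le_left (by positivity), hb, hss]
    have h42 : r ≤ r ^ 2 := by nlinarith
    have h43 : (r ^ 2 + r) * s ^ 2 ≤ (2 * r ^ 2) * s ^ 2 := by gcongr; linarith
    nlinarith [Real.pi_le_four]
  have h5 : D ≤ 7200 * r ^ 4 / s ^ 4 := by
    have h51 := Real.pow_div_factorial_le_exp (Real.exp r / (60 * r ^ 2)) (by positivity) 2
    rw [hD, Real.exp_neg]
    calc _ ≤ ((Real.exp r / (60 * r ^ 2)) ^ 2 / (Nat.factorial 2 : ℝ))⁻¹ := by gcongr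
      _ = _ := by
        rw [hss]
        norm_num [Nat.factorial]
        field_simp
        norm_num
  have h6 : r ^ 5 ≤ 3840 * s := by
    have := Real.pow_div_factorial_le_exp (r / 2) (by positivity) 5
    norm_num [Nat.factorial] at this
    linarith
  have h7 : √(b / (2 * Real.pi)) * (2 * Real.pi) * D ≤ 4 * 7200 * 3840 * Real.exp (-r) := by
    calc _ ≤ 4 * (r * s) * (7200 * r ^ 4 / s ^ 4) := by gcongr
      _ = 4 * 7200 * r ^ 5 / s ^ 3 := by field_simp
      _ ≤ 4 * 7200 * (3840 * s) / s ^ 3 := by gcongr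
      _ = _ := by
        rw [Real.exp_neg, hss]
        field_simp
  linarith

/-! ### Stirling's formula with a rate -/

/-- Robbins' stepwise bound makes `log (stirlingSeq n) - 1 / (12 n)` increase to `log √π`. -/
theorem log_stirlingSeq_le {n : ℕ} (hn : n ≠ 0) :
    Real.log (Stirling.stirlingSeq n) ≤ Real.log √Real.pi + 1 / (12 * n) := by
  have hmono : Monotone fun k : ℕ =>
      Real.log (Stirling.stirlingSeq (k + 1)) - 1 / (12 * ((k + 1 : ℕ) : ℝ)) := by
    refine monotone_nat_of_le_succ fun k => ?_
    have h := Stirling.log_stirlingSeq_sdiff_le (k + 1)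
    have h2 : 1 / (12 * ((k + 1 : ℕ) : ℝ) * (((k + 1 : ℕ) : ℝ) + 1)) =
        1 / (12 * ((k + 1 : ℕ) : ℝ)) - 1 / (12 * ((k + 1 + 1 : ℕ) : ℝ)) := by
      push_cast
      field_simp
      ring
    rw [h2] at h
    linarith
  have hlim : Filter.Tendsto (fun k : ℕ =>
      Real.log (Stirling.stirlingSeq (k + 1)) - 1 / (12 * ((k + 1 : ℕ) : ℝ)))
      Filter.atTop (nhds (Real.log √Real.pi - 0)) := by
    refine Filter.Tendsto.sub ?_ ?_
    · exact ((Real.continuousAt_log (by positivity)).tendsto.comp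
        Stirling.tendsto_stirlingSeq_sqrt_pi).comp (Filter.tendsto_add_atTop_nat 1)
    · have h := (tendsto_one_div_add_atTop_nhds_zero_nat (𝕜 := ℝ)).const_mul (1 / 12)
      rw [mul_zero] at h
      refine h.congr fun k => ?_
      push_cast
      field_simp
  obtain ⟨k, rfl⟩ := Nat.exists_eq_succ_of_ne_zero hn
  have := hmono.ge_of_tendsto hlim k
  simp only [Nat.succ_eq_add_one] at this ⊢
  linarith

theorem abs_stirlingSeq_div_sub_one_le {n : ℕ} (hn : n ≠ 0) :
    |Stirling.stirlingSeq n / √Real.pi - 1| ≤ 1 / n := by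
  have hpi : 0 < √Real.pi := by positivity
  have h1 := Stirling.sqrt_pi_le_stirlingSeq hn
  have hn1 : (1 : ℝ) ≤ n := by exact_mod_cast Nat.one_le_iff_ne_zero.2 hn
  have hle : Stirling.stirlingSeq n / √Real.pi ≤ Real.exp (1 / (12 * n)) := by
    rw [← Real.log_le_iff_le_exp (by have := hpi.trans_le h1; positivity),
      Real.log_div (by linarith) hpi.ne']
    linarith [log_stirlingSeq_le hn]
  have hge : 1 ≤ Stirling.stirlingSeq n / √Real.pi := by rwa [one_le_div hpi]
  have hx : (1 : ℝ) / (12 * n) = 1 / n / 12 := by field_simp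
  have hx0 : (0 : ℝ) < 1 / n := by positivity
  have hx1 : (1 : ℝ) / n ≤ 1 := by rw [div_le_one (by linarith)]; exact hn1
  have hexp := Real.abs_exp_sub_one_le (x := 1 / n / 12) (by rw [abs_of_pos] <;> linarith)
  rw [abs_of_pos (show (0 : ℝ) < 1 / n / 12 by linarith)] at hexp
  rw [abs_of_nonneg (by linarith)]
  rw [hx] at hle
  linarith [(abs_le.1 hexp).2]

/-! ### The asymptotic formula -/

/-- The exact factorisation of the Bell number at a saddle-point radius: main term, Stirling factor,
Laplace factor. -/
theorem bell_eq_main_mul {n : ℕ} {r : ℝ} (hr : 0 < r) (hn : r * Real.exp r = n) :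
    (Nat.bell n : ℝ) = Real.exp ((r - 1 + 1 / r) * n - 1) / √(r + 1) *
      ((Stirling.stirlingSeq n / √Real.pi) *
        (√((r ^ 2 + r) * Real.exp r / (2 * Real.pi)) *
          ∫ θ in -Real.pi..Real.pi, bellKernel r θ)) := by
  have hpi := Real.pi_pos
  have hn0 : (0 : ℝ) < n := by rw [← hn]; positivity
  have hint : (∫ θ in -Real.pi..Real.pi,
        Real.exp (Real.exp (r * Real.cos θ) * Real.cos (r * Real.sin θ) - 1) *
          Real.cos (Real.exp (r * Real.cos θ) * Real.sin (r * Real.sin θ) - n * θ)) =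
      Real.exp (Real.exp r - 1) * ∫ θ in -Real.pi..Real.pi, bellKernel r θ := by
    rw [← intervalIntegral.integral_const_mul]
    refine intervalIntegral.integral_congr fun θ _ => ?_
    simp only [bellKernel]
    rw [← mul_assoc, ← Real.exp_add, hn]
    ring_nf
  rw [bell_eq_integral n hr, hint]
  set J := ∫ θ in -Real.pi..Real.pi, bellKernel r θ
  have hfac : (n.factorial : ℝ) =
      Stirling.stirlingSeq n * (√(2 * n) * (n / Real.exp 1) ^ n) := by
    rw [Stirling.stirlingSeq]
    field_simp
  have hsq : √((r ^ 2 + r) * Real.exp r / (2 * Real.pi)) =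
      √(2 * n) * √(r + 1) / (2 * √Real.pi) := by
    rw [show (r ^ 2 + r) * Real.exp r / (2 * Real.pi) = (2 * n) * (r + 1) / (2 ^ 2 * Real.pi) by
      rw [← hn]; field_simp, Real.sqrt_div (by positivity), Real.sqrt_mul (by positivity),
      Real.sqrt_mul (x := 2 ^ 2) (by norm_num), Real.sqrt_sq (by norm_num)]
  have her : Real.exp r = n / r := by rw [← hn]; field_simp
  have hpow : (n / Real.exp 1 : ℝ) ^ n * Real.exp (Real.exp r - 1) =
      r ^ n * Real.exp ((r - 1 + 1 / r) * n - 1) := by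
    have h1 : (n / Real.exp 1 : ℝ) = r * Real.exp (r - 1) := by
      rw [← hn, Real.exp_sub]; ring
    rw [h1, mul_pow, ← Real.exp_nat_mul, mul_assoc, ← Real.exp_add, her]
    congr 2
    ring
  have hr1 : √(r + 1) ≠ 0 := by positivity
  have hr0 : r ^ n ≠ 0 := by positivity
  have hsp : √Real.pi ≠ 0 := by positivity
  rw [hfac, hsq]
  calc _ = Stirling.stirlingSeq n * √(2 * n) * J / (2 * Real.pi * r ^ n) *
        ((n / Real.exp 1 : ℝ) ^ n * Real.exp (Real.exp r - 1)) := by ring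
    _ = _ := by
      rw [hpow]
      field_simp
      rw [Real.sq_sqrt hpi.le]

theorem mainTheorem2 :
    ∃ E : ℕ → ℝ,
      E =O[Filter.atTop] (fun n : ℕ => (n : ℝ)⁻¹ * Real.log (n : ℝ) ^ 2) ∧
      ∀ᶠ n : ℕ in Filter.atTop,
        (Nat.bell n : ℝ) =
          Real.exp ((lambertW (n : ℝ) - 1 + 1 / lambertW (n : ℝ)) * (n : ℝ) - 1) /
              Real.sqrt (lambertW (n : ℝ) + 1) *
            (1 + E n) := by
  obtain ⟨C, hC0, hC⟩ := exists_abs_sqrt_mul_integral_bellKernel_sub_one_le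
  set S : ℕ → ℝ := fun n => Stirling.stirlingSeq n / √Real.pi
  set L : ℕ → ℝ := fun n =>
    √((lambertW n ^ 2 + lambertW n) * Real.exp (lambertW n) / (2 * Real.pi)) *
      ∫ θ in -Real.pi..Real.pi, bellKernel (lambertW n) θ
  have hW : ∀ n : ℕ, 1 ≤ n → lambertW n * Real.exp (lambertW n) = n := fun n _ =>
    (lambertW_spec (by linarith [Real.exp_pos (-1), Nat.cast_nonneg (α := ℝ) n])).2
  refine ⟨fun n => S n * L n - 1, ?_, ?_⟩
  · refine Asymptotics.IsBigO.of_bound (1 + 2 * C) ?_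
    filter_upwards [Filter.eventually_ge_atTop 3] with n hn3
    have hn : (3 : ℝ) ≤ n := by exact_mod_cast hn3
    have hw := hW n (by omega)
    set r := lambertW (n : ℝ) with hrdef
    have hr1 : 1 ≤ r := by
      have he : lambertW (1 * Real.exp 1) = 1 := lambertW_mul_exp_self (by norm_num)
      by_contra! hlt
      have hr0 : 0 < r := lambertW_pos (by linarith)
      have := Real.exp_lt_exp.2 hlt
      have := Real.exp_one_lt_d9
      nlinarith [Real.exp_pos r]
    -- `r e^r = n` gives `e^{-r} = r / n`, and `r ≤ log n` because `e^r ≤ n`.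
    have hrlog : r ≤ Real.log n := by
      rw [Real.le_log_iff_exp_le (by linarith), ← hw]
      exact le_mul_of_one_le_left (Real.exp_pos r).le hr1
    have hlog1 : 1 ≤ Real.log n := hr1.trans hrlog
    have hlogsq : Real.log n ≤ Real.log n ^ 2 := by nlinarith
    have hexp : Real.exp (-r) ≤ (n : ℝ)⁻¹ * Real.log n ^ 2 := by
      rw [Real.exp_neg, ← hw, mul_inv, mul_right_comm, ← div_eq_inv_mul]
      refine le_mul_of_one_le_left (by positivity) ?_
      rw [one_le_div (by linarith), hw]
      exact hrlog.trans hlogsq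
    have hninv : (1 : ℝ) / n ≤ (n : ℝ)⁻¹ * Real.log n ^ 2 := by
      rw [one_div]
      exact le_mul_of_one_le_right (by positivity) (hlog1.trans hlogsq)
    have hS : |S n - 1| ≤ 1 / n := abs_stirlingSeq_div_sub_one_le (by omega)
    have hL : |L n - 1| ≤ C * Real.exp (-r) := hC r hr1
    have hSle : |S n| ≤ 2 := by
      have h1 : (1 : ℝ) / n ≤ 1 := by rw [div_le_one (by linarith)]; linarith
      have h2 := abs_le.1 hS
      rw [abs_le]
      constructor <;> linarith
    have hsplit : S n * L n - 1 = S n * (L n - 1) + (S n - 1) := by ring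
    rw [Real.norm_eq_abs, Real.norm_of_nonneg (by positivity), hsplit]
    refine (abs_add_le _ _).trans ?_
    rw [abs_mul]
    have h3 : |S n| * |L n - 1| ≤ 2 * (C * ((n : ℝ)⁻¹ * Real.log n ^ 2)) := by
      gcongr
      exact hL.trans (by gcongr)
    linarith
  · filter_upwards [Filter.eventually_ge_atTop 1] with n hn
    have hr : 0 < lambertW (n : ℝ) := lambertW_pos (by exact_mod_cast hn)
    rw [add_sub_cancel]
    exact bell_eq_main_mul hr (hW n hn)
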